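/- Let $X$ be a complex Banach space and let $T$ be a bounded linear operator on $X$. For a bounded operator $S$ on a Banach space put $\alpha(S)=\dim\ker S$, $\beta(S)=\operatorname{codim}R(S)$ (with values in $\{0,1,2,\dots,\infty\}$), where $R(S)$ is the range of $S$. The operator $S$ is upper semi-Fredholm if $R(S)$ is closed and $\alpha(S)<\infty$; its index is then $\operatorname{ind}(S)=\alpha(S)-\beta(S)\in\mathbb Z\cup\{-\infty\}$. It is upper semi-Weyl if it is upper semi-Fredholm with $\operatorname{ind}(S)\le 0$. For $n\ge 0$ let $S_{[n]}:R(S^n)\to R(S^n)$ be the operator induced by $S$. The operator $S$ is upper semi-B-Fredholm if for some $n\ge 0$ the range $R(S^n)$ is closed and $S_{[n]}$ is upper semi-Fredholm; its index is then $\operatorname{ind}(S)=\operatorname{ind}(S_{[n]})$, which does not depend on the choice of such an $n$. It is upper semi-B-Weyl if it is upper semi-B-Fredholm with index $\le 0$. Let $\sigma_{uf}(T)$, $\sigma_{uw}(T)$, $\sigma_{ubf}(T)$, $\sigma_{ubw}(T)$ be the sets of all $\lambda\in\mathbb C$ for which $T-\lambda I$ is not upper semi-Fredholm, not upper semi-Weyl,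 not upper semi-B-Fredholm, not upper semi-B-Weyl, respectively. Let $\sigma(T)$ be the spectrum of $T$, and let $\sigma_a(T)$ be its approximate point spectrum, i.e. the set of all $\lambda$ for which $T-\lambda I$ is not bounded below. Let $\pi_0(T)$ be the set of isolated points of $\sigma(T)$ that are eigenvalues of $T$, and $\pi_{00}(T)$ the set of those $\lambda\in\pi_0(T)$ with $\alpha(T-\lambda I)<\infty$. One says that $T$ satisfies - property $(w)$ if $\sigma_a(T)\setminus\sigma_{uw}(T)=\pi_{00}(T)$; - property $(gw)$ if $\sigma_a(T)\setminus\sigma_{ubw}(T)=\pi_0(T)$; - property $(w_{\pi_{00}})$ if $\sigma_a(T)\setminus\sigma_{uf}(T)=\pi_{00}(T)$; - property $(gw_{\pi_{00}})$ if $\sigma_a(T)\setminus\sigma_{ubf}(T)=\pi_0(T)$. Theorem. For every bounded linear operator $T$ on a complex Banach space $X$: (i) $T$ satisfies property $(w_{\pi_{00}})$ if and only if $T$ satisfies property $(w)$ and $\sigma_{uf}(T)=\sigma_{uw}(T)$. (ii) $T$ satisfies property $(gw_{\pi_{00}})$ if and only if $T$ satisfies property $(gw)$ and $\sigma_{ubf}(T)=\sigma_{ubw}(T)$.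 -/

import Mathlib

open scoped ENNReal

namespace WeylType

noncomputable section

variable {X : Type*} [NormedAddCommGroup X] [NormedSpace ℂ X]

/-- The nullity `α(T) = dim N(T)`, an element of `{0, 1, 2, …, ∞}`. -/
def nullity (T : X →L[ℂ] X) : ℕ∞ :=
  Cardinal.toENat (Module.rank ℂ (LinearMap.ker (T : X →ₗ[ℂ] X)))

/-- The deficiency `β(T) = codim R(T)`, an element of `{0, 1, 2, …, ∞}`. -/
def deficiency (T : X →L[ℂ] X) : ℕ∞ :=
  Cardinal.toENat (Module.rank ℂ (X ⧸ LinearMap.range (T : X →ₗ[ℂ] X)))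

/-- The index `ind(T) = α(T) - β(T)`. It is only used when `α(T) < ∞`, where it is an integer
or `-∞`. -/
def index (T : X →L[ℂ] X) : EReal :=
  ((nullity T : ℝ≥0∞) : EReal) - ((deficiency T : ℝ≥0∞) : EReal)

/-- Upper semi-Fredholm operators: closed range and finite nullity. -/
def IsUpperSemiFredholm (T : X →L[ℂ] X) : Prop :=
  IsClosed (Set.range T) ∧ nullity T < ⊤

/-- Upper semi-Weyl operators: upper semi-Fredholm operators of nonpositive index. -/
def IsUpperSemiWeyl (T : X →L[ℂ] X) : Prop :=
  IsUpperSemiFredholm T ∧ index T ≤ 0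

/-- The range `R(T ^ n)`, as a linear subspace. -/
def powRange (T : X →L[ℂ] X) (n : ℕ) : Submodule ℂ X :=
  LinearMap.range ((T ^ n : X →L[ℂ] X) : X →ₗ[ℂ] X)

theorem mapsTo_powRange (T : X →L[ℂ] X) (n : ℕ) :
    ∀ x ∈ powRange T n, T x ∈ powRange T n := by
  rintro _ ⟨y, rfl⟩
  refine ⟨T y, ?_⟩
  change (T ^ n * T) y = (T * T ^ n) y
  rw [← pow_succ, ← pow_succ']

/-- The operator `T_[n] : R(T ^ n) → R(T ^ n)` induced by `T`. -/
def restrictPow (T : X →L[ℂ] X) (n : ℕ) : powRange T n →L[ℂ] powRange T n :=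
  (T.comp (powRange T n).subtypeL).codRestrict (powRange T n)
    fun x => mapsTo_powRange T n x x.2

/-- Upper semi-B-Fredholm operators: for some `n`, the range of `T ^ n` is closed and `T_[n]` is
upper semi-Fredholm. -/
def IsUpperSemiBFredholm (T : X →L[ℂ] X) : Prop :=
  ∃ n : ℕ, IsClosed (powRange T n : Set X) ∧ IsUpperSemiFredholm (restrictPow T n)

/-- Upper semi-B-Weyl operators: upper semi-B-Fredholm operators of nonpositive index, where the
index of an upper semi-B-Fredholm operator is the index of `T_[n]` for any `n` as in the definition
of that class (on a Banach space it does not depend on the choice of such an `n`). -/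
def IsUpperSemiBWeyl (T : X →L[ℂ] X) : Prop :=
  ∃ n : ℕ, IsClosed (powRange T n : Set X) ∧ IsUpperSemiFredholm (restrictPow T n) ∧
    index (restrictPow T n) ≤ 0

/-- `T - z I`. -/
def shift (T : X →L[ℂ] X) (z : ℂ) : X →L[ℂ] X :=
  T - z • ContinuousLinearMap.id ℂ X

/-- The approximate point spectrum `σ_a(T)`: all `z` for which `T - z I` is not bounded below. -/
def approxPointSpectrum (T : X →L[ℂ] X) : Set ℂ :=
  {z | ¬ ∃ c : ℝ, 0 < c ∧ ∀ x : X, c * ‖x‖ ≤ ‖shift T z x‖}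

/-- `σ_uf(T)`. -/
def upperSemiFredholmSpectrum (T : X →L[ℂ] X) : Set ℂ :=
  {z | ¬ IsUpperSemiFredholm (shift T z)}

/-- `σ_uw(T)`. -/
def upperSemiWeylSpectrum (T : X →L[ℂ] X) : Set ℂ :=
  {z | ¬ IsUpperSemiWeyl (shift T z)}

/-- `σ_ubf(T)`. -/
def upperSemiBFredholmSpectrum (T : X →L[ℂ] X) : Set ℂ :=
  {z | ¬ IsUpperSemiBFredholm (shift T z)}

/-- `σ_ubw(T)`. -/
def upperSemiBWeylSpectrum (T : X →L[ℂ] X) : Set ℂ :=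
  {z | ¬ IsUpperSemiBWeyl (shift T z)}

/-- The set `iso A` of isolated points of `A`. -/
def isolatedPoints (A : Set ℂ) : Set ℂ := A \ derivedSet A

/-- The set `σ_p(T)` of eigenvalues. -/
def eigenvalues (T : X →L[ℂ] X) : Set ℂ :=
  {z | Module.End.HasEigenvalue (T : X →ₗ[ℂ] X) z}

/-- The set `σ_p^f(T)` of eigenvalues of finite multiplicity. -/
def finiteEigenvalues (T : X →L[ℂ] X) : Set ℂ :=
  {z | z ∈ eigenvalues T ∧ nullity (shift T z) < ⊤}

/-- `π₀(T) = iso σ(T) ∩ σ_p(T)`. -/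
def piZero (T : X →L[ℂ] X) : Set ℂ := isolatedPoints (spectrum ℂ T) ∩ eigenvalues T

/-- `π₀₀(T) = iso σ(T) ∩ σ_p^f(T)`. -/
def piZeroZero (T : X →L[ℂ] X) : Set ℂ := isolatedPoints (spectrum ℂ T) ∩ finiteEigenvalues T

/-- Property `(w)`. -/
def PropertyW (T : X →L[ℂ] X) : Prop :=
  approxPointSpectrum T \ upperSemiWeylSpectrum T = piZeroZero T

/-- Property `(gw)`. -/
def PropertyGW (T : X →L[ℂ] X) : Prop :=
  approxPointSpectrum T \ upperSemiBWeylSpectrum T = piZero T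

/-- Property `(w_{π₀₀})`. -/
def PropertyWPi (T : X →L[ℂ] X) : Prop :=
  approxPointSpectrum T \ upperSemiFredholmSpectrum T = piZeroZero T

/-- Property `(gw_{π₀₀})`. -/
def PropertyGWPi (T : X →L[ℂ] X) : Prop :=
  approxPointSpectrum T \ upperSemiBFredholmSpectrum T = piZero T

end

end WeylType

open Filter Topology

namespace WeylType

section Index

variable {Y : Type*} [NormedAddCommGroup Y] [NormedSpace ℂ Y]

/-! Given equality of the two spectra, each equivalence is substitution. What must be proved is that
(w_{π₀₀}) or (gw_{π₀₀}) forces index ≤ 0 wherever S = T - z is (B-)Fredholm. If z lies outside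
σ_a(T), S is injective. Otherwise the property makes z isolated in σ(T), so S - μ is bijective for
small μ ≠ 0, and `nullity_le_deficiency_of_frequently_bijective` gives α(S) ≤ β(S) without index
theory. The B-case applies the same lemma to S_[n] on the Banach space R(S^n). -/

theorem index_nonpos_of_nullity_le_deficiency {S : Y →L[ℂ] Y}
    (h : nullity S ≤ deficiency S) : index S ≤ 0 := by
  have h' : ((nullity S : ℝ≥0∞) : EReal) ≤ ((deficiency S : ℝ≥0∞) : EReal) := by
    exact_mod_cast h
  exact EReal.sub_nonpos.2 h'

theorem nullity_eq_zero_of_injective {S : Y →L[ℂ] Y} (h : Function.Injective S) :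
    nullity S = 0 := by
  have hk : LinearMap.ker (S : Y →ₗ[ℂ] Y) = ⊥ := LinearMap.ker_eq_bot.2 h
  rw [nullity, hk]
  simp

theorem finiteDimensional_ker_of_nullity_lt_top {S : Y →L[ℂ] Y} (h : nullity S < ⊤) :
    FiniteDimensional ℂ (LinearMap.ker (S : Y →ₗ[ℂ] Y)) :=
  Module.rank_lt_aleph0_iff.1 (Cardinal.toENat_lt_top.1 h)

/-- If `S` has finite nullity and `S - μ` is bijective for some `μ` arbitrarily close to `0`,
then the nullity of `S` is at most its deficiency. -/
theorem nullity_le_deficiency_of_frequently_bijective [CompleteSpace Y] {S : Y →L[ℂ] Y}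
    (hS : nullity S < ⊤) (hf : ∃ᶠ μ in 𝓝 (0 : ℂ), Function.Bijective (shift S μ)) :
    nullity S ≤ deficiency S := by
  by_cases hd : deficiency S < ⊤
  swap
  · exact (not_lt_top_iff.1 hd).symm ▸ le_top
  have := finiteDimensional_ker_of_nullity_lt_top hS
  have : FiniteDimensional ℂ (Y ⧸ LinearMap.range (S : Y →ₗ[ℂ] Y)) :=
    Module.rank_lt_aleph0_iff.1 (Cardinal.toENat_lt_top.1 hd)
  set K := LinearMap.ker (S : Y →ₗ[ℂ] Y) with hK
  set R := LinearMap.range (S : Y →ₗ[ℂ] Y) with hR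
  obtain ⟨p, hp⟩ := Submodule.ClosedComplemented.of_finiteDimensional K
  obtain ⟨F, hF⟩ := Submodule.exists_isCompl R
  have eF : (Y ⧸ R) ≃ₗ[ℂ] F := Submodule.quotientEquivOfIsCompl R F hF
  have : FiniteDimensional ℂ F := LinearEquiv.finiteDimensional eF
  set M := LinearMap.ker (p : Y →ₗ[ℂ] K) with hM
  have hMc : IsClosed (M : Set Y) := p.isClosed_ker
  have : CompleteSpace M := hMc.completeSpace_coe
  have : CompleteSpace F := FiniteDimensional.complete ℂ F
  -- M complements ker S and F complements R(S), so Φ 0 is an isomorphism. Isomorphisms form an open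
  -- set, hence Φ μ stays surjective for small μ.
  let Φ : ℂ → (M × F) →L[ℂ] Y := fun μ =>
    ((shift S μ).comp M.subtypeL).coprod F.subtypeL
  have hΦ (μ : ℂ) (m : M) (f : F) : Φ μ (m, f) = shift S μ m + f := by simp [Φ]
  have hΦ0 (m : M) (f : F) : Φ 0 (m, f) = S m + f := by simp [hΦ, shift]
  have hcont : Continuous Φ := by
    have : Φ = fun μ => (S.comp M.subtypeL).coprod F.subtypeL -
        μ • (M.subtypeL.comp (ContinuousLinearMap.fst ℂ M F)) := by
      funext μ
      ext x <;> simp [Φ, shift]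
    rw [this]
    fun_prop
  have hinj : Function.Injective (Φ 0) := by
    rw [injective_iff_map_eq_zero]
    rintro ⟨m, f⟩ h
    rw [hΦ0] at h
    have hf0 : (f : Y) = 0 := by
      refine Submodule.disjoint_def.1 hF.disjoint f ?_ f.2
      rw [eq_neg_of_add_eq_zero_right h]
      exact R.neg_mem ⟨m, rfl⟩
    have hm : (m : Y) ∈ K := by
      rw [hf0, add_zero] at h
      exact h
    have hm0 : (m : Y) = 0 := by
      have h1 := hp ⟨m, hm⟩
      have h2 : p m = 0 := m.2
      rw [h2] at h1
      exact (congrArg Subtype.val h1).symm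
    exact Prod.ext (Subtype.ext hm0) (Subtype.ext hf0)
  have hsurj : Function.Surjective (Φ 0) := by
    intro y
    obtain ⟨_, ⟨x, rfl⟩, f, hf, rfl⟩ :=
      Submodule.mem_sup.1 (hF.sup_eq_top ▸ Submodule.mem_top : y ∈ R ⊔ F)
    have hm : x - p x ∈ M := by
      change p (x - p x) = 0
      rw [map_sub, hp, sub_self]
    refine ⟨(⟨x - p x, hm⟩, ⟨f, hf⟩), ?_⟩
    have hk : S (p x) = 0 := (p x).2
    simp [hΦ0, hk]
  let e := ContinuousLinearEquiv.ofBijective (Φ 0) (LinearMap.ker_eq_bot.2 hinj)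
    (LinearMap.range_eq_top.2 hsurj)
  have he : (e : (M × F) →L[ℂ] Y) = Φ 0 := ContinuousLinearEquiv.coe_ofBijective _ _ _
  have hnhds : ∀ᶠ μ in 𝓝 (0 : ℂ), Function.Surjective (Φ μ) := by
    have h1 := hcont.continuousAt.eventually (he ▸ ContinuousLinearEquiv.nhds e)
    filter_upwards [h1] with μ hμ
    obtain ⟨e', he'⟩ := hμ
    rw [← he']
    exact e'.surjective
  obtain ⟨μ, hbij, hμ⟩ := (hf.and_eventually hnhds).exists
  let A : Y ≃ₗ[ℂ] Y := LinearEquiv.ofBijective (shift S μ : Y →ₗ[ℂ] Y) hbij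
  have hA (y : Y) : A y = shift S μ y := rfl
  -- Surjectivity of Φ μ says A(M) + F = Y, i.e. M + A⁻¹(F) = Y. Projecting along M maps A⁻¹(F) onto
  -- K, so dim K ≤ dim F = β(S).
  let q : F →ₗ[ℂ] K := (p : Y →ₗ[ℂ] K) ∘ₗ (A.symm : Y →ₗ[ℂ] Y) ∘ₗ F.subtype
  have hq : Function.Surjective q := by
    intro k
    obtain ⟨⟨m, f⟩, hmf⟩ := hμ (A k)
    refine ⟨f, ?_⟩
    have hfe : (f : Y) = A (k - m) := by
      rw [map_sub, ← hmf, hΦ, hA, add_sub_cancel_left]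
    have hm : p m = 0 := m.2
    change p (A.symm f) = k
    rw [hfe, LinearEquiv.symm_apply_apply, map_sub, hp, hm, sub_zero]
  exact OrderHomClass.mono Cardinal.toENat
    ((LinearMap.rank_le_of_surjective q hq).trans_eq eF.rank_eq.symm)

end Index

section Shift

variable {X : Type*} [NormedAddCommGroup X] [NormedSpace ℂ X]

theorem shift_shift (T : X →L[ℂ] X) (z μ : ℂ) : shift (shift T z) μ = shift T (z + μ) := by
  simp only [shift, add_smul, sub_sub]

theorem bijective_shift_of_notMem_spectrum {T : X →L[ℂ] X} {z : ℂ} (h : z ∉ spectrum ℂ T) :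
    Function.Bijective (shift T z) := by
  have hu : IsUnit (shift T z) := by
    -- Mathlib's spectrum is defined through z - T, the negative of `shift T z`.
    have h1 := (spectrum.notMem_iff.1 h).neg
    rw [neg_sub] at h1
    exact h1
  obtain ⟨u, hu⟩ := hu
  rw [← hu]
  refine Function.bijective_iff_has_inverse.2
    ⟨((u⁻¹ : (X →L[ℂ] X)ˣ) : X →L[ℂ] X), fun x => ?_, fun x => ?_⟩
  · exact congrArg (fun A : X →L[ℂ] X => A x) u.inv_mul
  · exact congrArg (fun A : X →L[ℂ] X => A x) u.mul_inv

theorem frequently_bijective_shift_of_mem_isolatedPoints {T : X →L[ℂ] X} {z : ℂ}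
    (hz : z ∈ isolatedPoints (spectrum ℂ T)) :
    ∃ᶠ μ in 𝓝 (0 : ℂ), Function.Bijective (shift (shift T z) μ) := by
  have h1 : ∀ᶠ w in 𝓝[≠] z, w ∉ spectrum ℂ T := by
    have h2 := hz.2
    rw [mem_derivedSet, accPt_iff_frequently_nhdsNE, not_frequently] at h2
    exact h2
  have h3 : Tendsto (fun μ => z + μ) (𝓝[≠] (0 : ℂ)) (𝓝[≠] z) := by
    refine tendsto_nhdsWithin_of_tendsto_nhds_of_eventually_within _ ?_ ?_
    · exact (Continuous.tendsto' (by fun_prop) _ _ (add_zero z)).mono_left nhdsWithin_le_nhds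
    · filter_upwards [self_mem_nhdsWithin] with μ hμ
      simpa using hμ
  refine ((h3.eventually h1).mono fun μ hμ => ?_).frequently.filter_mono nhdsWithin_le_nhds
  rw [shift_shift]
  exact bijective_shift_of_notMem_spectrum hμ

/-- S - μ commutes with S^n, so the preimage of S^n x is S^n w, where (S - μ) w = x. -/
theorem bijective_shift_restrictPow {S : X →L[ℂ] X} {μ : ℂ}
    (h : Function.Bijective (shift S μ)) (n : ℕ) :
    Function.Bijective (shift (restrictPow S n) μ) := by
  have hcoe (x : powRange S n) : (shift (restrictPow S n) μ x : X) = shift S μ x := rfl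
  refine ⟨fun x y hxy => Subtype.ext (h.1 ?_), ?_⟩
  · rw [← hcoe, ← hcoe, hxy]
  · rintro ⟨_, x, rfl⟩
    obtain ⟨w, rfl⟩ := h.2 x
    refine ⟨⟨(S ^ n) w, w, rfl⟩, Subtype.ext ?_⟩
    rw [hcoe]
    have hc : Commute (shift S μ) (S ^ n) := by
      refine Commute.pow_right ?_ n
      exact (Commute.refl S).sub_left ((Commute.one_left S).smul_left μ)
    exact congrArg (fun A : X →L[ℂ] X => A w) hc.eq

theorem isUpperSemiWeyl_of_frequently_bijective [CompleteSpace X] {S : X →L[ℂ] X}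
    (hS : IsUpperSemiFredholm S)
    (hf : ∃ᶠ μ in 𝓝 (0 : ℂ), Function.Bijective (shift S μ)) : IsUpperSemiWeyl S :=
  ⟨hS, index_nonpos_of_nullity_le_deficiency
    (nullity_le_deficiency_of_frequently_bijective hS.2 hf)⟩

theorem isUpperSemiBWeyl_of_frequently_bijective [CompleteSpace X] {S : X →L[ℂ] X}
    (hS : IsUpperSemiBFredholm S)
    (hf : ∃ᶠ μ in 𝓝 (0 : ℂ), Function.Bijective (shift S μ)) : IsUpperSemiBWeyl S := by
  obtain ⟨n, hn, hS⟩ := hS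
  -- Closedness of R(S^n) makes it a Banach space, as the Fredholm case requires.
  have : CompleteSpace (powRange S n) := hn.completeSpace_coe
  exact ⟨n, hn, isUpperSemiWeyl_of_frequently_bijective hS
    (hf.mono fun μ hμ => bijective_shift_restrictPow hμ n)⟩

theorem injective_shift_of_notMem_approxPointSpectrum {T : X →L[ℂ] X} {z : ℂ}
    (h : z ∉ approxPointSpectrum T) : Function.Injective (shift T z) := by
  obtain ⟨c, hc, hb⟩ := not_not.1 h
  rw [injective_iff_map_eq_zero]
  intro x hx
  have := hb x
  rw [hx, norm_zero] at this
  exact norm_le_zero_iff.1 (nonpos_of_mul_nonpos_right this hc)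

theorem index_nonpos_of_injective {S : X →L[ℂ] X} (h : Function.Injective S) : index S ≤ 0 :=
  index_nonpos_of_nullity_le_deficiency (nullity_eq_zero_of_injective h ▸ zero_le)

theorem injective_restrictPow {S : X →L[ℂ] X} (h : Function.Injective S) (n : ℕ) :
    Function.Injective (restrictPow S n) :=
  fun _ _ hxy => Subtype.ext (h (congrArg Subtype.val hxy))

theorem upperSemiFredholmSpectrum_eq_of_propertyWPi [CompleteSpace X] {T : X →L[ℂ] X}
    (h : PropertyWPi T) : upperSemiFredholmSpectrum T = upperSemiWeylSpectrum T := by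
  ext z
  refine not_congr ⟨fun hz => ?_, fun hz => hz.1⟩
  by_cases ha : z ∈ approxPointSpectrum T
  · have hp : z ∈ piZeroZero T := h ▸ ⟨ha, not_not.2 hz⟩
    exact isUpperSemiWeyl_of_frequently_bijective hz
      (frequently_bijective_shift_of_mem_isolatedPoints hp.1)
  · exact ⟨hz, index_nonpos_of_injective (injective_shift_of_notMem_approxPointSpectrum ha)⟩

theorem upperSemiBFredholmSpectrum_eq_of_propertyGWPi [CompleteSpace X] {T : X →L[ℂ] X}
    (h : PropertyGWPi T) : upperSemiBFredholmSpectrum T = upperSemiBWeylSpectrum T := by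
  ext z
  refine not_congr ⟨fun hz => ?_, fun ⟨n, hn, hz, _⟩ => ⟨n, hn, hz⟩⟩
  by_cases ha : z ∈ approxPointSpectrum T
  · have hp : z ∈ piZero T := h ▸ ⟨ha, not_not.2 hz⟩
    exact isUpperSemiBWeyl_of_frequently_bijective hz
      (frequently_bijective_shift_of_mem_isolatedPoints hp.1)
  · obtain ⟨n, hn, hz⟩ := hz
    exact ⟨n, hn, hz, index_nonpos_of_injective
      (injective_restrictPow (injective_shift_of_notMem_approxPointSpectrum ha) n)⟩

end Shift

end WeylType

theorem mainTheorem1 {X : Type*} [NormedAddCommGroup X] [NormedSpace ℂ X] [CompleteSpace X]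
    (T : X →L[ℂ] X) :
    (WeylType.PropertyWPi T ↔
      WeylType.PropertyW T ∧
        WeylType.upperSemiFredholmSpectrum T = WeylType.upperSemiWeylSpectrum T) ∧
    (WeylType.PropertyGWPi T ↔
      WeylType.PropertyGW T ∧
        WeylType.upperSemiBFredholmSpectrum T = WeylType.upperSemiBWeylSpectrum T) := by
  refine ⟨⟨fun h => ?_, fun ⟨h, he⟩ => ?_⟩, ⟨fun h => ?_, fun ⟨h, he⟩ => ?_⟩⟩
  · have he := WeylType.upperSemiFredholmSpectrum_eq_of_propertyWPi h
    exact ⟨by rwa [WeylType.PropertyW, ← he], he⟩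
  · rwa [WeylType.PropertyWPi, he]
  · have he := WeylType.upperSemiBFredholmSpectrum_eq_of_propertyGWPi h
    exact ⟨by rwa [WeylType.PropertyGW, ← he], he⟩
  · rwa [WeylType.PropertyGWPi, he]
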